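/- Let $S$ be a finite nonempty set and let $A\in\mathbb{Q}^{S\times S}$. Consider the symmetric bimatrix game $\Gamma$ in which both players have the pure strategy set $S$ and the utilities are $u_1(s,t)=A_{st}$ and $u_2(s,t)=A_{ts}$. Let $\Delta(S)$ be the set of probability vectors indexed by $S$, and view probability distributions on $S\times S$ as real $S\times S$ matrices $W$. Such a $W$ is a correlated equilibrium if for every function $f:S\to S$ $$\sum_{s,t}\bigl(u_1(f(s),t)-u_1(s,t)\bigr)W_{st}\le 0\quad\text{and}\quad \sum_{s,t}\bigl(u_2(s,f(t))-u_2(s,t)\bigr)W_{st}\le 0,$$ and it is an exchangeable equilibrium if moreover the two players' actions are conditionally i.i.d. under $W$, i.e. $W$ lies in the convex hull of $\{xx^T : x\in\Delta(S)\}$. Then $\Gamma$ has an exchangeable equilibrium all of whose entries are rational numbers. More precisely, there is a vector $w\in\Delta(S)\cap\mathbb{Q}^S$ such that $(w,w)$ is a Nash equilibrium of $\Gamma$ (no player gains by a unilateral deviation to a pure strategy) and $ww^T$ is an exchangeable equilibrium of $\Gamma$ with rational entries. -/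

import Mathlib

/-- A bimatrix game with pure strategy sets `S` (rows, player 1) and `T` (columns, player 2):
`A s t` and `B s t` are the utilities of players 1 and 2 at the strategy profile `(s, t)`. -/
structure BimatrixGame (S T : Type*) where
  A : Matrix S T ℝ
  B : Matrix S T ℝ

namespace BimatrixGame

/-- Both players have the same strategy set and `u₁(s₁, s₂) = u₂(s₂, s₁)`. -/
def IsSymmetric {S : Type*} (Γ : BimatrixGame S S) : Prop :=
  Γ.B = Γ.A.transpose

/-- The probability distributions on `S × T`, viewed as matrices. -/
def jointDistributions (S T : Type*) [Fintype S] [Fintype T] : Set (Matrix S T ℝ) :=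
  {W | (∀ s t, 0 ≤ W s t) ∧ ∑ s, ∑ t, W s t = 1}

/-- The linear extension `U(W) = ∑ U(s, t) W(s, t)` of a utility function to distributions. -/
def expectedUtility {S T : Type*} [Fintype S] [Fintype T] (U W : Matrix S T ℝ) : ℝ :=
  ∑ s, ∑ t, U s t * W s t

/-- `(x, y)` is a mixed strategy profile (`stdSimplex ℝ S` is the set of probability vectors
indexed by `S`) from which no player gains by a unilateral deviation to a pure strategy.
`Matrix.vecMulVec x y` is the product distribution `x yᵀ`, and `Pi.single t 1` is the pure
strategy `t`. -/
def IsNash {S T : Type*} [Fintype S] [Fintype T] [DecidableEq S] [DecidableEq T]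
    (Γ : BimatrixGame S T) (x : S → ℝ) (y : T → ℝ) : Prop :=
  x ∈ stdSimplex ℝ S ∧ y ∈ stdSimplex ℝ T ∧
  (∀ s : S, expectedUtility Γ.A (Matrix.vecMulVec (Pi.single s 1) y) ≤
    expectedUtility Γ.A (Matrix.vecMulVec x y)) ∧
  (∀ t : T, expectedUtility Γ.B (Matrix.vecMulVec x (Pi.single t 1)) ≤
    expectedUtility Γ.B (Matrix.vecMulVec x y))

/-- The set of (direct) correlated equilibria: distributions of recommended strategy profiles
such that no player gains in expectation by applying a function to the recommendation. -/
def correlatedEquilibria {S T : Type*} [Fintype S] [Fintype T]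
    (Γ : BimatrixGame S T) : Set (Matrix S T ℝ) :=
  {W | W ∈ jointDistributions S T ∧
    (∀ f : S → S, ∑ s, ∑ t, (Γ.A (f s) t - Γ.A s t) * W s t ≤ 0) ∧
    (∀ f : T → T, ∑ s, ∑ t, (Γ.B s (f t) - Γ.B s t) * W s t ≤ 0)}

/-- The symmetric product (i.i.d.) distributions `w wᵀ`, for `w` a probability vector. -/
def symmetricProducts (S : Type*) [Fintype S] : Set (Matrix S S ℝ) :=
  {W | ∃ w ∈ stdSimplex ℝ S, W = Matrix.vecMulVec w w}

/-- The exchangeable equilibria: the correlated equilibria in the convex hull of the symmetric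
product distributions, i.e. those in which the actions are conditionally i.i.d. -/
def exchangeableEquilibria {S : Type*} [Fintype S] (Γ : BimatrixGame S S) :
    Set (Matrix S S ℝ) :=
  Γ.correlatedEquilibria ∩ convexHull ℝ (symmetricProducts S)

end BimatrixGame

/-- The matrices all of whose entries are rational numbers. -/
def rationalMatrices (S T : Type*) : Set (Matrix S T ℝ) :=
  {W | ∀ s t, ∃ q : ℚ, W s t = (q : ℝ)}

/-! If `w` is a mixed strategy supported on best responses to itself, then `(w, w)` is Nash. Under
`w wᵀ` a recommendation carries no information about the opponent, so `w wᵀ` is also a correlated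
equilibrium. It remains to find a rational `w`.

Over the reals, `exists_symmetric_equilibrium` replaces a fixed point theorem by Scarf's lemma
`exists_isDominant_image_eq_univ`, itself a parity count. Colouring each grid point by a best
response to it yields clusters of nearby points that give approximate equilibria, and compactness
gives an exact one.

Rationality uses no vertex argument: by `exists_rat_linearMap_pos` there is a `ℚ`-linear `φ : ℝ → ℚ`
keeping the finitely many relevant positive reals positive. It commutes with the rational matrix
`A`, so applying it to the coordinates of a real equilibrium and normalizing preserves all
equilibrium conditions. -/

/-! ### Dominant sets and Scarf's lemma -/

/-- With respect to a family `r` of rankings, a finite set is dominant when no element of the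
ambient type lies strictly above the minimum of the set in every ranking. -/
def IsDominant {X I L : Type*} [LinearOrder L] (r : I → X → L) (σ : Finset X) : Prop :=
  ∀ y, ∃ i, ∀ x ∈ σ, r i y ≤ r i x

lemma IsDominant.mono {X I L : Type*} [LinearOrder L] {r : I → X → L} {σ τ : Finset X}
    (h : IsDominant r σ) (hτ : τ ⊆ σ) : IsDominant r τ := fun y =>
  (h y).imp fun _ hi x hx => hi x (hτ hx)

/-- Two rankings `k ≠ l` attaining their minimum over `τ` at the same place: the best element that
beats `τ` in every ranking but `k` extends the dominant set `τ`. -/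
lemma IsDominant.exists_insert {X I L : Type*} [Finite X] [DecidableEq X] [LinearOrder L]
    {r : I → X → L} (hr : ∀ i, Function.Injective (r i)) {τ : Finset X} (hτ : IsDominant r τ)
    {m : I → X} (hm : ∀ i, m i ∈ τ) (hmin : ∀ i, ∀ x ∈ τ, r i (m i) ≤ r i x)
    {k l : I} (hkl : l ≠ k) (hmkl : m l = m k)
    (hM : ∃ y, ∀ p, p ≠ k → r p (m p) < r p y) :
    ∃ x, x ∉ τ ∧ IsDominant r (insert x τ) ∧ (∀ p, p ≠ k → r p (m p) < r p x) ∧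
      r k x ≤ r k (m k) ∧ ∀ y, (∀ p, p ≠ k → r p (m p) < r p y) → r k y ≤ r k x := by
  obtain ⟨x, hx, hmax⟩ := Set.exists_max_image {y | ∀ p, p ≠ k → r p (m p) < r p y} (r k)
    (Set.toFinite _) hM
  have hk : ∀ z ∈ τ, r k x ≤ r k z := by
    obtain ⟨p, hp⟩ := hτ x
    by_cases hpk : p = k
    · exact hpk ▸ hp
    · exact absurd (hp _ (hm p)) (not_le.2 (hx p hpk))
  refine ⟨x, fun hxτ => ?_, fun y => ?_, hx, hk _ (hm k), hmax⟩
  · have : x = m k := hr k (le_antisymm (hk _ (hm k)) (hmin k x hxτ))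
    have h2 := hx l hkl
    rw [this, hmkl] at h2
    exact lt_irrefl _ h2
  · by_cases hy : ∀ p, p ≠ k → r p (m p) < r p y
    · refine ⟨k, fun z hz => ?_⟩
      rcases Finset.mem_insert.1 hz with rfl | hz
      · exact hmax y hy
      · exact (hmax y hy).trans (hk z hz)
    · push Not at hy
      obtain ⟨p, hpk, hp⟩ := hy
      refine ⟨p, fun z hz => ?_⟩
      rcases Finset.mem_insert.1 hz with rfl | hz
      · exact hp.trans (hx p hpk).le
      · exact hp.trans (hmin p z hz)

/-- An interior facet lies in exactly two dominant sets with one more element. -/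
lemma IsDominant.card_insert {X I L : Type*} [Fintype X] [DecidableEq X] [Fintype I]
    [DecidableEq I] [LinearOrder L] {r : I → X → L} [DecidablePred (IsDominant r)]
    (hr : ∀ i, Function.Injective (r i))
    {τ : Finset X} (hτ : IsDominant r τ) (hcard : τ.card + 1 = Fintype.card I)
    (hne : τ.Nonempty) (hM : ∀ k, ∃ y, ∀ p, p ≠ k → ∃ x ∈ τ, r p x < r p y) :
    (Finset.univ.filter fun x => x ∉ τ ∧ IsDominant r (insert x τ)).card = 2 := by
  have hmex : ∀ i, ∃ x ∈ τ, ∀ z ∈ τ, r i x ≤ r i z := fun i => τ.exists_min_image (r i) hne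
  choose m hm hmin using hmex
  have hM' : ∀ k, ∃ y, ∀ p, p ≠ k → r p (m p) < r p y := fun k => by
    obtain ⟨y, hy⟩ := hM k
    refine ⟨y, fun p hp => ?_⟩
    obtain ⟨x, hx, hxy⟩ := hy p hp
    exact (hmin p x hx).trans_lt hxy
  -- Pigeonhole: there is one more ranking than elements of `τ`, so two rankings share their
  -- minimum. Each of the two can be freed for a new element, giving the two extensions.
  obtain ⟨i, -, j, -, hij, hmij⟩ := Finset.exists_ne_map_eq_of_card_lt_of_maps_to
    (s := (Finset.univ : Finset I)) (t := τ) (f := m)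
    (by rw [Finset.card_univ]; omega) (fun p _ => hm p)
  obtain ⟨a, haτ, hadom, haM, hai, hamax⟩ := hτ.exists_insert hr hm hmin hij.symm hmij.symm (hM' i)
  obtain ⟨b, hbτ, hbdom, hbM, hbj, hbmax⟩ := hτ.exists_insert hr hm hmin hij hmij (hM' j)
  have hab : a ≠ b := by
    rintro rfl
    exact absurd hai (not_le.2 (hbM i hij))
  rw [Finset.card_eq_two]
  refine ⟨a, b, hab, ?_⟩
  ext x
  simp only [Finset.mem_filter, Finset.mem_univ, true_and, Finset.mem_insert,
    Finset.mem_singleton]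
  refine ⟨?_, ?_⟩
  swap
  · rintro (rfl | rfl)
    exacts [⟨haτ, hadom⟩, ⟨hbτ, hbdom⟩]
  rintro ⟨hxτ, hx⟩
  obtain ⟨k, hk⟩ := hx x
  -- every element of `τ` is the minimum of a ranking in which `x` is not minimal
  have hcov : ∀ z ∈ τ, ∃ p, r p (m p) < r p x ∧ m p = z := fun z hz => by
    obtain ⟨p, hp⟩ := hx z
    have h1 : m p = z := hr p (le_antisymm (hmin p z hz) (hp _ (Finset.mem_insert_of_mem (hm p))))
    refine ⟨p, ?_, h1⟩
    rw [h1]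
    refine lt_of_le_of_ne (hp x (Finset.mem_insert_self _ _)) fun h => hxτ ?_
    rwa [← hr p h]
  -- `P` collects the rankings whose minimum `x` does not take over. Their minima cover `τ` and `k`
  -- is not among them, so by counting `P` omits only `k` and `m` is injective on `P`. Since `m i =
  -- m j`, this forces `k = i` or `k = j`.
  set P := Finset.univ.filter fun p => r p (m p) < r p x with hP
  have hkP : k ∉ P := by
    simp only [hP, Finset.mem_filter, Finset.mem_univ, true_and, not_lt]
    exact hk _ (Finset.mem_insert_of_mem (hm k))
  have himg : τ ⊆ P.image m := fun z hz => by
    obtain ⟨p, hp, hpz⟩ := hcov z hz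
    exact Finset.mem_image.2 ⟨p, by simpa [hP] using hp, hpz⟩
  have hPsub : P ⊆ Finset.univ.erase k := fun p hp =>
    Finset.mem_erase.2 ⟨fun h => hkP (h ▸ hp), Finset.mem_univ _⟩
  have hcardk : (Finset.univ.erase k).card = τ.card := by
    rw [Finset.card_erase_of_mem (Finset.mem_univ _), Finset.card_univ]; omega
  have hPeq : P = Finset.univ.erase k := Finset.eq_of_subset_of_card_le hPsub
    (hcardk ▸ (Finset.card_le_card himg).trans Finset.card_image_le)
  have hinj : Set.InjOn m P := Finset.injOn_of_card_image_eq
    (le_antisymm Finset.card_image_le (by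
      rw [hPeq, hcardk]; rw [hPeq] at himg; exact Finset.card_le_card himg))
  have hxM : ∀ p, p ≠ k → r p (m p) < r p x := fun p hp => by
    have : p ∈ P := by rw [hPeq]; exact Finset.mem_erase.2 ⟨hp, Finset.mem_univ _⟩
    simpa [hP] using this
  have huniq : ∀ c, (∀ p, p ≠ k → r p (m p) < r p c) → r k x ≤ r k c → x = c := fun c hc hxc => by
    obtain ⟨p, hp⟩ := hx c
    by_cases hpk : p = k
    · subst hpk
      exact hr p (le_antisymm hxc (hp x (Finset.mem_insert_self _ _)))
    · exact absurd (hp _ (Finset.mem_insert_of_mem (hm p))) (not_le.2 (hc p hpk))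
  by_cases hki : k = i
  · subst hki
    exact Or.inl (huniq a haM (hamax x hxM))
  by_cases hkj : k = j
  · subst hkj
    exact Or.inr (huniq b hbM (hbmax x hxM))
  · refine absurd (hinj ?_ ?_ hmij) hij <;> rw [hPeq] <;> simp [Ne.symm hki, Ne.symm hkj]

/-- A set with as many elements as there are colours, not all of which occur in it, has an even
number of facets carrying exactly the colours other than `i₀`. -/
lemma even_card_filter_image_erase {X I : Type*} [DecidableEq X] [Fintype I] [DecidableEq I]
    (c : X → I) (i₀ : I) {σ : Finset X} (hcard : σ.card = Fintype.card I)
    (hσ : σ.image c ≠ Finset.univ) :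
    Even (σ.filter fun x => (σ.erase x).image c = Finset.univ.erase i₀).card := by
  rcases (σ.filter fun x => (σ.erase x).image c = Finset.univ.erase i₀).eq_empty_or_nonempty
    with h | ⟨x, hx⟩
  · simp [h]
  obtain ⟨hxσ, hx⟩ := Finset.mem_filter.1 hx
  have himg : σ.image c = insert (c x) (Finset.univ.erase i₀) := by
    rw [← hx, ← Finset.image_insert, Finset.insert_erase hxσ]
  have hxi : c x ≠ i₀ := fun h => hσ (by rw [himg, h, Finset.insert_erase (Finset.mem_univ _)])
  have hinj : Set.InjOn c (σ.erase x) := Finset.injOn_of_card_image_eq (by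
    rw [hx, Finset.card_erase_of_mem (Finset.mem_univ _), Finset.card_erase_of_mem hxσ, hcard,
      Finset.card_univ])
  have himg' : σ.image c = Finset.univ.erase i₀ := by
    rw [himg, Finset.insert_eq_of_mem (Finset.mem_erase.2 ⟨hxi, Finset.mem_univ _⟩)]
  obtain ⟨x', hx', hcx⟩ : ∃ x' ∈ σ.erase x, c x' = c x := by
    rw [← Finset.mem_image, hx]
    exact Finset.mem_erase.2 ⟨hxi, Finset.mem_univ _⟩
  have hxx : x' ≠ x := (Finset.mem_erase.1 hx').1
  suffices h : (σ.filter fun x => (σ.erase x).image c = Finset.univ.erase i₀) = {x, x'} by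
    rw [h, Finset.card_pair hxx.symm]; exact even_two
  ext z
  simp only [Finset.mem_filter, Finset.mem_insert, Finset.mem_singleton]
  constructor
  · rintro ⟨hzσ, hz⟩
    by_contra! hne
    have : c z ∈ (σ.erase z).image c := by
      rw [hz, ← himg']; exact Finset.mem_image_of_mem _ hzσ
    obtain ⟨z', hz', hcz⟩ := Finset.mem_image.1 this
    obtain ⟨hzz, hz'⟩ := Finset.mem_erase.1 hz'
    have hzx : z ∈ σ.erase x := Finset.mem_erase.2 ⟨hne.1, hzσ⟩
    by_cases h : z' = x
    · subst h
      exact hne.2 (hinj hzx hx' (hcz.symm.trans hcx.symm))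
    · exact hzz (hinj (Finset.mem_coe.2 (Finset.mem_erase.2 ⟨h, hz'⟩)) hzx hcz)
  · rintro (rfl | rfl)
    · exact ⟨hxσ, hx⟩
    · refine ⟨(Finset.mem_erase.1 hx').2, ?_⟩
      rw [← himg']
      refine (Finset.image_subset_image (Finset.erase_subset _ _)).antisymm fun i hi => ?_
      obtain ⟨y, hy, rfl⟩ := Finset.mem_image.1 hi
      by_cases h : y = z
      · rw [h, hcx]
        exact Finset.mem_image_of_mem _ (Finset.mem_erase.2 ⟨hxx.symm, hxσ⟩)
      · exact Finset.mem_image_of_mem _ (Finset.mem_erase.2 ⟨h, hy⟩)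

/-- A form of **Scarf's lemma**. Each ranking `r i` has a slack element `e i` at its bottom, and
all other slack elements on top. Then for any colouring in which `e i` has colour `i` there is a
dominant set containing each colour exactly once. -/
theorem exists_isDominant_image_eq_univ {X I L : Type*} [Fintype X] [DecidableEq X] [Fintype I]
    [DecidableEq I] [Nonempty I] [LinearOrder L] {r : I → X → L}
    (hr : ∀ i, Function.Injective (r i)) (e : I → X) (hbot : ∀ i y, r i (e i) ≤ r i y)
    (htop : ∀ i k, k ≠ i → ∀ y, y ∉ Set.range e → r i y < r i (e k))
    (hT : ∃ y, y ∉ Set.range e) (c : X → I) (hc : ∀ i, c (e i) = i) :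
    ∃ σ : Finset X, IsDominant r σ ∧ σ.card = Fintype.card I ∧ σ.image c = Finset.univ := by
  classical
  by_contra! hcon
  obtain ⟨i₀⟩ := ‹Nonempty I›
  have he : Function.Injective e := fun i j h => by rw [← hc i, h, hc]
  have hlt : ∀ i y, y ≠ e i → r i (e i) < r i y := fun i y hy =>
    lt_of_le_of_ne (hbot i y) fun h => hy (hr i h).symm
  -- Parity count of incident room-door pairs. Without a fully coloured room every room has evenly
  -- many doors, whereas every door lies in two rooms except the boundary door `d₀`, which lies in
  -- one.
  set rooms : Finset (Finset X) :=
    Finset.univ.filter fun σ => IsDominant r σ ∧ σ.card = Fintype.card I with hrooms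
  set doors : Finset (Finset X) := Finset.univ.filter fun τ =>
    IsDominant r τ ∧ τ.card + 1 = Fintype.card I ∧ τ.image c = Finset.univ.erase i₀ with hdoors
  have hcount := Finset.sum_card_bipartiteAbove_eq_sum_card_bipartiteBelow
    (s := rooms) (t := doors) (fun σ τ => τ ⊆ σ)
  have hroom : ∀ σ ∈ rooms, Even (doors.bipartiteAbove (fun σ τ => τ ⊆ σ) σ).card := by
    intro σ hσ
    obtain ⟨hσd, hσc⟩ := (Finset.mem_filter.1 hσ).2
    convert even_card_filter_image_erase c i₀ hσc (hcon σ hσd hσc) using 1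
    rw [← Finset.card_image_of_injOn (f := fun x => σ.erase x)]
    · congr 1
      ext τ
      simp only [Finset.mem_bipartiteAbove, hdoors, Finset.mem_filter, Finset.mem_univ, true_and,
        Finset.mem_image]
      constructor
      · rintro ⟨⟨-, hτc, hτi⟩, hτσ⟩
        obtain ⟨x, hx⟩ : ∃ x, σ \ τ = {x} := Finset.card_eq_one.1 (by
          rw [Finset.card_sdiff_of_subset hτσ]; omega)
        have hxm : x ∈ σ \ τ := by rw [hx]; exact Finset.mem_singleton_self _
        have : σ.erase x = τ := by
          rw [Finset.erase_eq, ← hx, Finset.sdiff_sdiff_eq_self hτσ]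
        exact ⟨x, ⟨(Finset.mem_sdiff.1 hxm).1, by rw [this, hτi]⟩, this⟩
      · rintro ⟨x, ⟨hx, hxi⟩, rfl⟩
        exact ⟨⟨hσd.mono (Finset.erase_subset _ _), by rw [Finset.card_erase_add_one hx, hσc], hxi⟩,
          Finset.erase_subset _ _⟩
    · intro x hx y _ hxy
      exact (Finset.erase_inj σ (Finset.mem_filter.1 hx).1).1 hxy
  have hdoor : ∀ τ ∈ doors, (rooms.bipartiteBelow (fun σ τ => τ ⊆ σ) τ).card =
      (Finset.univ.filter fun x => x ∉ τ ∧ IsDominant r (insert x τ)).card := by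
    intro τ hτ
    obtain ⟨hτd, hτc, hτi⟩ := (Finset.mem_filter.1 hτ).2
    rw [← Finset.card_image_of_injOn (f := fun x => insert x τ)]
    · congr 1
      ext σ
      simp only [Finset.mem_bipartiteBelow, hrooms, Finset.mem_filter, Finset.mem_univ, true_and,
        Finset.mem_image]
      constructor
      · rintro ⟨⟨hσd, hσc⟩, hτσ⟩
        obtain ⟨x, hx, rfl⟩ := (Finset.covBy_iff_exists_insert.1
          ((Finset.covBy_iff_card_sdiff_eq_one).2 ⟨hτσ, by
            rw [Finset.card_sdiff_of_subset hτσ]; omega⟩))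
        exact ⟨x, ⟨hx, hσd⟩, rfl⟩
      · rintro ⟨x, ⟨hx, hxd⟩, rfl⟩
        exact ⟨⟨hxd, by rw [Finset.card_insert_of_notMem hx, hτc]⟩, Finset.subset_insert _ _⟩
    · intro x hx y _ hxy
      exact (Finset.insert_inj (Finset.mem_filter.1 hx).2.1).1 hxy
  set d₀ : Finset X := (Finset.univ.erase i₀).image e with hd₀
  have hd₀mem : d₀ ∈ doors := by
    refine Finset.mem_filter.2 ⟨Finset.mem_univ _, fun y => ?_, ?_, ?_⟩
    · by_cases hy : y ∈ Set.range e
      · obtain ⟨k, rfl⟩ := hy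
        exact ⟨k, fun x _ => hbot k x⟩
      · refine ⟨i₀, fun x hx => ?_⟩
        obtain ⟨k, hk, rfl⟩ := Finset.mem_image.1 hx
        exact (htop i₀ k (Finset.ne_of_mem_erase hk) y hy).le
    · rw [Finset.card_image_of_injective _ he, Finset.card_erase_add_one (Finset.mem_univ _),
        Finset.card_univ]
    · rw [Finset.image_image, show c ∘ e = id from funext hc, Finset.image_id]
  have hd₀e : ∀ k, k ≠ i₀ → e k ∈ d₀ := fun k hk =>
    Finset.mem_image_of_mem _ (Finset.mem_erase.2 ⟨hk, Finset.mem_univ _⟩)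
  -- The only extension of `d₀` is by the non-slack element ranked highest by `i₀`.
  have hone : (rooms.bipartiteBelow (fun σ τ => τ ⊆ σ) d₀).card = 1 := by
    obtain ⟨a, ha, hamax⟩ := Set.exists_max_image {y | y ∉ Set.range e} (r i₀) (Set.toFinite _) hT
    have hane : ∀ k, a ≠ e k := fun k h => ha ⟨k, h.symm⟩
    rw [hdoor d₀ hd₀mem, Finset.card_eq_one]
    refine ⟨a, ?_⟩
    ext x
    simp only [Finset.mem_filter, Finset.mem_univ, true_and, Finset.mem_singleton]
    constructor
    · rintro ⟨hxd, hx⟩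
      obtain ⟨p, hp⟩ := hx a
      have hpe : e p ∉ insert x d₀ := fun h => (hp _ h).not_gt (hlt p a (hane p))
      have hpi : p = i₀ := by
        by_contra h
        exact hpe (Finset.mem_insert_of_mem (hd₀e p h))
      subst hpi
      refine hr p (le_antisymm (hamax x ?_) (hp x (Finset.mem_insert_self _ _)))
      rintro ⟨k, rfl⟩
      by_cases hk : k = p
      · exact hpe (hk ▸ Finset.mem_insert_self _ _)
      · exact hxd (hd₀e k hk)
    · rintro rfl
      refine ⟨fun h => ?_, fun y => ?_⟩
      · obtain ⟨k, -, hk⟩ := Finset.mem_image.1 h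
        exact hane k hk.symm
      · by_cases hy : y ∈ Set.range e
        · obtain ⟨k, rfl⟩ := hy
          exact ⟨k, fun x _ => hbot k x⟩
        · refine ⟨i₀, fun z hz => ?_⟩
          rcases Finset.mem_insert.1 hz with rfl | hz
          · exact hamax y hy
          · obtain ⟨k, hk, rfl⟩ := Finset.mem_image.1 hz
            exact (htop i₀ k (Finset.ne_of_mem_erase hk) y hy).le
  have htwo : ∀ τ ∈ doors, τ ≠ d₀ → (rooms.bipartiteBelow (fun σ τ => τ ⊆ σ) τ).card = 2 := by
    intro τ hτ hne
    rw [hdoor τ hτ]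
    obtain ⟨hτd, hτc, hτi⟩ := (Finset.mem_filter.1 hτ).2
    -- The colours force an all-slack door to be `d₀`. Any other door has a non-slack `z`, which `e
    -- k` beats in every ranking but `k`, so the door is interior.
    obtain ⟨z, hzτ, hz⟩ : ∃ z ∈ τ, z ∉ Set.range e := by
      by_contra! h
      refine hne (Finset.eq_of_subset_of_card_le (fun x hx => ?_) ?_)
      · obtain ⟨k, rfl⟩ := h x hx
        refine hd₀e k (Finset.ne_of_mem_erase (s := Finset.univ) ?_)
        rw [← hτi, Finset.mem_image]
        exact ⟨_, hx, hc k⟩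
      · have := (Finset.mem_filter.1 hd₀mem).2.2.1
        omega
    exact hτd.card_insert hr hτc ⟨z, hzτ⟩ fun k => ⟨e k, fun p hp => ⟨z, hzτ, htop p k hp.symm z hz⟩⟩
  rw [← Finset.add_sum_erase _ _ hd₀mem, hone] at hcount
  have h1 : Even (∑ σ ∈ rooms, (doors.bipartiteAbove (fun σ τ => τ ⊆ σ) σ).card) :=
    Finset.even_sum _ hroom
  have h2 : Even (∑ τ ∈ doors.erase d₀, (rooms.bipartiteBelow (fun σ τ => τ ⊆ σ) τ).card) :=
    Finset.even_sum _ fun τ hτ => by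
      rw [htwo τ (Finset.mem_of_mem_erase hτ) (Finset.ne_of_mem_erase hτ)]; exact even_two
  rw [hcount] at h1
  exact (Nat.not_even_iff_odd.2 (h2.one_add)) h1

/-! ### Rational functionals preserving positivity -/

/-- Finitely many positive real numbers are simultaneously positive under some `ℚ`-linear
functional. -/
lemma exists_rat_linearMap_pos (F : Finset ℝ) :
    ∃ φ : ℝ →ₗ[ℚ] ℚ, ∀ x ∈ F, 0 < x → 0 < φ x := by
  set V := Submodule.span ℚ (F : Set ℝ)
  have : FiniteDimensional ℚ V := FiniteDimensional.span_finset ℚ F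
  set b := Module.finBasis ℚ V
  have hopen : IsOpen {v : Fin (Module.finrank ℚ V) → ℝ |
      ∀ x : F, 0 < (x : ℝ) →
        0 < ∑ i, ((b.repr ⟨x, Submodule.subset_span x.2⟩ i : ℚ) : ℝ) * v i} := by
    simp only [Set.ofPred_forall]
    refine isOpen_iInter_of_finite fun x => isOpen_iInter_of_finite fun _ => ?_
    exact isOpen_lt continuous_const (by fun_prop)
  have hdense : DenseRange fun (q : Fin (Module.finrank ℚ V) → ℚ) i => (q i : ℝ) :=
    DenseRange.piMap fun _ => Rat.denseRange_cast
  -- The values `b i` themselves, which define the inclusion of `V` in `ℝ`, satisfy the open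
  -- conditions, so some rational values do too.
  obtain ⟨q, hq⟩ := hdense.exists_mem_open hopen ⟨fun i => (b i : ℝ), fun x hx => by
    have h := congrArg Subtype.val (b.sum_repr ⟨x, Submodule.subset_span x.2⟩)
    simp only [Submodule.coe_sum, Submodule.coe_smul, Rat.smul_def] at h
    rwa [h]⟩
  obtain ⟨φ, hφ⟩ := LinearMap.exists_extend (b.constr ℚ q)
  refine ⟨φ, fun x hx hpos => ?_⟩
  have h1 : φ x = ∑ i, b.repr ⟨x, Submodule.subset_span hx⟩ i * q i := by
    have := LinearMap.congr_fun hφ ⟨x, Submodule.subset_span hx⟩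
    simpa [Module.Basis.constr_apply_fintype] using this
  have h2 : 0 < ∑ i, ((b.repr ⟨x, Submodule.subset_span hx⟩ i : ℚ) : ℝ) * (q i : ℝ) :=
    hq ⟨x, hx⟩ hpos
  rw [h1]
  exact_mod_cast h2

/-! ### Real symmetric equilibria -/

/-- Approximate symmetric equilibria of integer grids: `x` and, for each `i`, either `x i` is small
or `i` is a best response to a point close to `x`. -/
lemma exists_grid_approx {S : Type*} [Fintype S] [Nonempty S] (β : (S → ℕ) → S) (N : ℕ) :
    ∃ x : S → ℕ, ∑ i, x i = N ∧ ∀ i, x i ≤ Fintype.card S ∨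
      ∃ y : S → ℕ, ∑ i, y i = N ∧ β y = i ∧
        ∀ j, y j ≤ x j + Fintype.card S ∧ x j ≤ y j + Fintype.card S := by
  classical
  let T := {x : S → ℕ // x ∈ Finset.piAntidiag Finset.univ N}
  let _ : Fintype T := Finset.Subtype.fintype _
  let mk : ∀ y : S → ℕ, ∑ i, y i = N → T := fun y hy =>
    ⟨y, Finset.mem_piAntidiag.2 ⟨hy, fun i _ => Finset.mem_univ i⟩⟩
  have hsum : ∀ x : T, ∑ i, x.1 i = N := fun x => (Finset.mem_piAntidiag.1 x.2).1
  -- The shift by 1 puts slack `i` strictly below every grid point; `N + 2` exceeds every shifted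
  -- coordinate. Ties are broken in `r` by an enumeration.
  let g : S → T ⊕ S → ℕ := fun i =>
    Sum.elim (fun x => x.1 i + 1) fun k => if k = i then 0 else N + 2
  let c : T ⊕ S → S := Sum.elim (fun x => β x.1) id
  let r : S → T ⊕ S → ℕ ×ₗ Fin (Fintype.card (T ⊕ S)) := fun i y =>
    toLex (g i y, Fintype.equivFin _ y)
  have hrlt : ∀ i y z, g i y < g i z → r i y < r i z := fun i y z h =>
    Prod.Lex.toLex_lt_toLex.2 (Or.inl h)
  have hgle : ∀ i y z, r i y ≤ r i z → g i y ≤ g i z := fun i y z h =>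
    not_lt.1 fun h' => (hrlt i z y h').not_ge h
  have hr : ∀ i, Function.Injective (r i) := fun i y z h =>
    (Fintype.equivFin _).injective (congrArg (fun p => (ofLex p).2) h)
  have hgT : ∀ (x : T) i, g i (Sum.inl x) ≤ N + 1 := fun x i => by
    have := Finset.single_le_sum (f := x.1) (fun _ _ => Nat.zero_le _) (Finset.mem_univ i)
    rw [hsum] at this
    simpa [g] using this
  have hgpos : ∀ (i : S) (y : T ⊕ S), y ≠ Sum.inr i → 0 < g i y := by
    rintro i (x | k) h
    · simp [g]
    · have : k ≠ i := fun h' => h (by rw [h'])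
      simp [g, this]
  have hg0 : ∀ i, g i (Sum.inr i) = 0 := fun i => by simp [g]
  have hpile : ∀ μ : S → ℕ, ∑ i, μ i ≤ N → ∃ y : T, ∀ i, μ i ≤ y.1 i := fun μ hμ => by
    obtain ⟨i₀⟩ := ‹Nonempty S›
    refine ⟨mk (μ + Pi.single i₀ (N - ∑ i, μ i)) ?_, fun i => Nat.le_add_right _ _⟩
    simp only [Pi.add_apply, Finset.sum_add_distrib, Finset.sum_pi_single', Finset.mem_univ, if_true]
    omega
  obtain ⟨t₀, -⟩ := hpile 0 (by simp)
  obtain ⟨σ, hσ, -, hσc⟩ := exists_isDominant_image_eq_univ hr Sum.inr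
    (fun i y => by
      by_cases h : y = Sum.inr i
      · rw [h]
      · exact (hrlt _ _ _ ((hg0 i).trans_lt (hgpos i y h))).le)
    (fun i k hk y hy => hrlt _ _ _ (by
      rcases y with x | l
      · exact (hgT x i).trans_lt (by simp [g, hk])
      · exact absurd ⟨l, rfl⟩ hy))
    ⟨Sum.inl t₀, by simp⟩ c (fun i => rfl)
  have hdom : ∀ y, ∃ i, ∀ x ∈ σ, g i y ≤ g i x := fun y =>
    (hσ y).imp fun i hi x hx => hgle _ _ _ (hi x hx)
  have hcol : ∀ i, Sum.inr i ∈ σ ∨ ∃ y : T, Sum.inl y ∈ σ ∧ β y.1 = i := fun i => by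
    obtain ⟨y, hy, hyi⟩ := Finset.mem_image.1 (hσc ▸ Finset.mem_univ i : i ∈ σ.image c)
    rcases y with y | k
    · exact Or.inr ⟨y, hy, hyi⟩
    · exact Or.inl (by rwa [← show k = i from hyi])
  obtain ⟨x, hx⟩ : ∃ x : T, Sum.inl x ∈ σ := by
    obtain ⟨i, hi⟩ := hdom (Sum.inl t₀)
    rcases hcol i with h | ⟨y, hy, -⟩
    · exact absurd (hi _ h) (by rw [hg0]; simp [g])
    · exact ⟨y, hy⟩
  choose m hm hmin using fun i => σ.exists_min_image (g i) ⟨_, hx⟩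
  -- Otherwise some grid point would beat all the minima at once, contradicting dominance. Hence the
  -- shifted coordinates of a grid point in `σ` exceed the minima by less than `card S` in total, so
  -- such points are close together.
  have hμ : N + 1 ≤ ∑ i, g i (m i) := by
    by_contra! h
    obtain ⟨y, hy⟩ := hpile (fun i => g i (m i)) (by omega)
    obtain ⟨i, hi⟩ := hdom (Sum.inl y)
    have h1 : y.1 i + 1 ≤ g i (m i) := hi _ (hm i)
    have h2 := hy i
    omega
  have hlow : ∀ y : T, Sum.inl y ∈ σ → ∀ i, g i (m i) ≤ y.1 i + 1 := fun y hy i => hmin i _ hy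
  have hup : ∀ y : T, Sum.inl y ∈ σ → ∀ i, y.1 i + 1 + 1 ≤ g i (m i) + Fintype.card S :=
    fun y hy i => by
      have h1 := Finset.single_le_sum (f := fun j => y.1 j + 1 - g j (m j))
        (fun _ _ => Nat.zero_le _) (Finset.mem_univ i)
      have h2 : ∑ j, (y.1 j + 1 - g j (m j)) + ∑ j, g j (m j) = N + Fintype.card S := by
        rw [← Finset.sum_add_distrib, Finset.sum_congr rfl fun j _ => Nat.sub_add_cancel (hlow y hy j),
          Finset.sum_add_distrib, hsum]
        simp
      have h3 := hlow y hy i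
      omega
  refine ⟨x.1, hsum x, fun i => ?_⟩
  rcases hcol i with h | ⟨y, hy, hyi⟩
  · have h1 := hmin i _ h
    have h2 := hup x hx i
    rw [hg0] at h1
    exact Or.inl (by omega)
  · refine Or.inr ⟨y.1, hsum y, hyi, fun j => ?_⟩
    have h1 := hup x hx j
    have h2 := hup y hy j
    have h3 := hlow x hx j
    have h4 := hlow y hy j
    omega

open Matrix

/-- Every symmetric two-player game has a symmetric equilibrium. -/
theorem exists_symmetric_equilibrium {S : Type*} [Fintype S] [Nonempty S] (A : Matrix S S ℝ) :
    ∃ x ∈ stdSimplex ℝ S, ∀ i j, x i = 0 ∨ (A *ᵥ x) j ≤ (A *ᵥ x) i := by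
  classical
  -- On the simplex `ψ` is nonnegative and vanishes exactly at symmetric equilibria.
  let ψ : (S → ℝ) → ℝ := fun x => ∑ i, ∑ j, min (x i) (max 0 ((A *ᵥ x) j - (A *ᵥ x) i))
  have hmv : ∀ i, Continuous fun x : S → ℝ => (A *ᵥ x) i := fun i => by
    simp only [mulVec, dotProduct]; fun_prop
  have hψ : Continuous ψ := continuous_finsetSum _ fun i _ => continuous_finsetSum _ fun j _ =>
    (continuous_apply i).min (continuous_const.max ((hmv j).sub (hmv i)))
  have hne : (stdSimplex ℝ S).Nonempty := ⟨_, single_mem_stdSimplex ℝ (Classical.arbitrary S)⟩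
  obtain ⟨x, hx, hxmin⟩ := (isCompact_stdSimplex ℝ S).exists_isMinOn hne hψ.continuousOn
  have hterm : ∀ i j, 0 ≤ min (x i) (max 0 ((A *ᵥ x) j - (A *ᵥ x) i)) := fun i j =>
    le_min (hx.1 i) (le_max_left _ _)
  suffices hzero : ψ x ≤ 0 by
    refine ⟨x, hx, fun i j => ?_⟩
    have h1 : min (x i) (max 0 ((A *ᵥ x) j - (A *ᵥ x) i)) ≤ 0 :=
      ((Finset.single_le_sum (fun j _ => hterm i j) (Finset.mem_univ j)).trans
        (Finset.single_le_sum (f := fun i => ∑ j, min (x i) (max 0 ((A *ᵥ x) j - (A *ᵥ x) i)))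
          (fun i _ => Finset.sum_nonneg fun j _ => hterm i j) (Finset.mem_univ i))).trans hzero
    rcases min_le_iff.1 h1 with h | h
    · exact Or.inl (le_antisymm h (hx.1 i))
    · exact Or.inr (sub_nonpos.1 ((le_max_right _ _).trans h))
  set n : ℝ := (Fintype.card S : ℝ) with hn
  set K : ℝ := ∑ i, ∑ j, |A i j| with hK
  have hK0 : 0 ≤ K := Finset.sum_nonneg fun i _ => Finset.sum_nonneg fun j _ => abs_nonneg _
  have hn0 : 0 ≤ n := Nat.cast_nonneg _
  -- Moving each coordinate by at most `n / N` changes a payoff by at most `K * (n / N)`. Comparing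
  -- two payoffs doubles this; the remaining `n / N` covers small weights.
  have happrox : ∀ N : ℕ, 0 < N → ψ x ≤ n * n * (n * (1 + 2 * K)) / N := by
    intro N hN
    have hN' : (0 : ℝ) < N := Nat.cast_pos.2 hN
    have hbest : ∀ y : S → ℝ, ∃ i, ∀ j, (A *ᵥ y) j ≤ (A *ᵥ y) i := fun y => by
      obtain ⟨i, -, hi⟩ := Finset.univ.exists_max_image (A *ᵥ y) Finset.univ_nonempty
      exact ⟨i, fun j => hi j (Finset.mem_univ j)⟩
    choose b hb using hbest
    obtain ⟨u, hu, hu'⟩ := exists_grid_approx (fun y => b fun i => (y i : ℝ) / N) N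
    have hmem : (fun i => (u i : ℝ) / N) ∈ stdSimplex ℝ S :=
      ⟨fun i => by positivity, by
        rw [← Finset.sum_div, ← Nat.cast_sum, hu, div_self hN'.ne']⟩
    refine (hxmin hmem).trans ?_
    have hbound : ∀ i j, min ((u i : ℝ) / N) (max 0 ((A *ᵥ fun i => (u i : ℝ) / N) j -
        (A *ᵥ fun i => (u i : ℝ) / N) i)) ≤ n * (1 + 2 * K) / N := by
      intro i j
      rcases hu' i with h | ⟨y, -, hyi, hy⟩
      · refine (min_le_left _ _).trans (div_le_div_of_nonneg_right ?_ hN'.le)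
        have : (u i : ℝ) ≤ n := by rw [hn]; exact_mod_cast h
        nlinarith
      · refine (min_le_right _ _).trans (max_le (by positivity) ?_)
        have hclose : ∀ k, |(A *ᵥ fun i => (u i : ℝ) / N) k - (A *ᵥ fun i => (y i : ℝ) / N) k| ≤
            K * (n / N) := by
          intro k
          simp only [mulVec, dotProduct, ← Finset.sum_sub_distrib, ← mul_sub, ← sub_div]
          refine (Finset.abs_sum_le_sum_abs _ _).trans ?_
          refine (Finset.sum_le_sum (g := fun l => |A k l| * (n / N)) fun l _ => ?_).trans ?_
          · rw [abs_mul, abs_div, abs_of_pos hN']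
            have h1 : (y l : ℝ) ≤ u l + n := by rw [hn]; exact_mod_cast (hy l).1
            have h2 : (u l : ℝ) ≤ y l + n := by rw [hn]; exact_mod_cast (hy l).2
            have : |(u l : ℝ) - y l| ≤ n := abs_le.2 ⟨by linarith, by linarith⟩
            gcongr
          · rw [← Finset.sum_mul]
            refine mul_le_mul_of_nonneg_right ?_ (by positivity)
            exact Finset.single_le_sum (f := fun i => ∑ j, |A i j|)
              (fun i _ => Finset.sum_nonneg fun j _ => abs_nonneg _) (Finset.mem_univ k)
        have h1 := abs_le.1 (hclose j)
        have h2 := abs_le.1 (hclose i)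
        have h3 := hb (fun i => (y i : ℝ) / N) j
        rw [hyi] at h3
        have h4 : n * (1 + 2 * K) / N = n / N + 2 * (K * (n / N)) := by ring
        have h5 : 0 ≤ n / N := by positivity
        linarith [h1.2, h2.1]
    refine (Finset.sum_le_sum fun i _ => Finset.sum_le_sum fun j _ => hbound i j).trans_eq ?_
    simp only [Finset.sum_const, Finset.card_univ, nsmul_eq_mul, ← hn]
    ring
  refine ge_of_tendsto (tendsto_const_div_atTop_nhds_zero_nat (n * n * (n * (1 + 2 * K)))) ?_
  filter_upwards [Filter.eventually_gt_atTop 0] with N hN using happrox N hN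

/-! ### Rational symmetric equilibria -/

/-- A symmetric two-player game with rational payoffs has a rational symmetric equilibrium. -/
theorem exists_rat_symmetric_equilibrium {S : Type*} [Fintype S] [Nonempty S] (A : Matrix S S ℚ) :
    ∃ w ∈ stdSimplex ℚ S, ∀ i j, w i = 0 ∨ (A *ᵥ w) j ≤ (A *ᵥ w) i := by
  classical
  obtain ⟨x, hx, hxA⟩ := exists_symmetric_equilibrium (A.map ((↑) : ℚ → ℝ))
  set B : Matrix S S ℝ := A.map ((↑) : ℚ → ℝ)
  -- The element 1 allows normalization, the coordinates keep weights nonnegative, and the payoff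
  -- differences keep best responses.
  obtain ⟨φ, hφ⟩ := exists_rat_linearMap_pos (insert 1 (Finset.univ.image x ∪
    Finset.univ.image fun p : S × S => (B *ᵥ x) p.1 - (B *ᵥ x) p.2))
  have h1 : 0 < φ 1 := hφ 1 (Finset.mem_insert_self _ _) one_pos
  have hsum : ∑ i, φ (x i) = φ 1 := by rw [← map_sum, hx.2]
  have hφx : ∀ i, 0 ≤ φ (x i) := fun i => by
    rcases (hx.1 i).eq_or_lt with h | h
    · rw [← h, map_zero]
    · exact (hφ _ (by simp) h).le
  have hmv : ∀ i, φ ((B *ᵥ x) i) = (A *ᵥ fun j => φ (x j)) i := fun i => by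
    simp only [mulVec, dotProduct, map_sum, B, Matrix.map_apply]
    exact Finset.sum_congr rfl fun j _ => by rw [← Rat.smul_def, map_smul, smul_eq_mul]
  refine ⟨(φ 1)⁻¹ • fun i => φ (x i), ⟨fun i => ?_, ?_⟩, fun i j => ?_⟩
  · exact mul_nonneg (inv_nonneg.2 h1.le) (hφx i)
  · simp only [Pi.smul_apply, smul_eq_mul, ← Finset.mul_sum, hsum, inv_mul_cancel₀ h1.ne']
  · refine (hxA i j).imp (fun h => by simp [h]) fun h => ?_
    rw [mulVec_smul, Pi.smul_apply, Pi.smul_apply, smul_eq_mul, smul_eq_mul, ← hmv, ← hmv]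
    refine mul_le_mul_of_nonneg_left ?_ (inv_nonneg.2 h1.le)
    rcases h.eq_or_lt with h | h
    · rw [h]
    · rw [← sub_nonneg, ← map_sub]
      refine (hφ _ ?_ (sub_pos.2 h)).le
      exact Finset.mem_insert_of_mem (Finset.mem_union_right _
        (Finset.mem_image.2 ⟨(i, j), Finset.mem_univ _, rfl⟩))

/-! ### From symmetric to exchangeable equilibria -/

lemma BimatrixGame.expectedUtility_vecMulVec {S T : Type*} [Fintype S] [Fintype T]
    (U : Matrix S T ℝ) (x : S → ℝ) (y : T → ℝ) :
    expectedUtility U (vecMulVec x y) = x ⬝ᵥ U *ᵥ y := by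
  simp only [expectedUtility, vecMulVec_apply, mulVec, dotProduct, Finset.mul_sum]
  exact Finset.sum_congr rfl fun _ _ => Finset.sum_congr rfl fun _ _ => by ring

theorem theorem3p3 {S : Type*} [Fintype S] [DecidableEq S] [Nonempty S]
    (Γ : BimatrixGame S S) (hsymm : Γ.IsSymmetric) (hrat : Γ.A ∈ rationalMatrices S S) :
    ∃ W ∈ Γ.exchangeableEquilibria ∩ rationalMatrices S S,
      ∃ w : S → ℝ, (∀ s, ∃ q : ℚ, w s = (q : ℝ)) ∧ Γ.IsNash w w ∧
        W = Matrix.vecMulVec w w := by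
  choose A hA using hrat
  obtain ⟨w, hw, hwA⟩ := exists_rat_symmetric_equilibrium (Matrix.of A)
  set v : S → ℝ := fun s => (w s : ℝ) with hv
  have hv0 : ∀ s, 0 ≤ v s := fun s => Rat.cast_nonneg.2 (hw.1 s)
  have hvS : v ∈ stdSimplex ℝ S := ⟨hv0, by
    rw [← Rat.cast_one (α := ℝ), ← hw.2, Rat.cast_sum]⟩
  have hmv : ∀ s, (Γ.A *ᵥ v) s = (((Matrix.of A) *ᵥ w) s : ℚ) := fun s => by
    simp [mulVec, dotProduct, hA, hv]
  have hgain : ∀ s t, v s * ((Γ.A *ᵥ v) t - (Γ.A *ᵥ v) s) ≤ 0 := fun s t => by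
    rcases hwA s t with h | h
    · simp [hv, h]
    · refine mul_nonpos_of_nonneg_of_nonpos (hv0 s) (sub_nonpos.2 ?_)
      rw [hmv, hmv]
      exact_mod_cast h
  have hdev : ∀ f : S → S, ∑ s, v s * ((Γ.A *ᵥ v) (f s) - (Γ.A *ᵥ v) s) ≤ 0 := fun f =>
    Finset.sum_nonpos fun s _ => hgain s (f s)
  have hB : Γ.B = Γ.Aᵀ := hsymm
  have hpure : ∀ s, (Γ.A *ᵥ v) s ≤ v ⬝ᵥ Γ.A *ᵥ v := fun s => by
    -- A pure deviation is the constant function `s`, and the weights `v` sum to 1.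
    have := hdev fun _ => s
    simp only [mul_sub, Finset.sum_sub_distrib, ← Finset.sum_mul, hvS.2, one_mul] at this
    simpa [dotProduct] using this
  have hcorr : ∀ f : S → S, ∑ s, ∑ t, (Γ.A (f s) t - Γ.A s t) * (v s * v t) ≤ 0 := fun f => by
    refine (Finset.sum_congr rfl fun s _ => ?_).trans_le (hdev f)
    simp only [mulVec, dotProduct, ← Finset.sum_sub_distrib, Finset.mul_sum]
    exact Finset.sum_congr rfl fun t _ => by ring
  refine ⟨vecMulVec v v, ⟨⟨⟨⟨fun s t => ?_, ?_⟩, hcorr, fun f => ?_⟩, ?_⟩, fun s t => ?_⟩,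
    v, fun s => ⟨w s, rfl⟩, ⟨hvS, hvS, fun s => ?_, fun t => ?_⟩, rfl⟩
  · exact mul_nonneg (hv0 s) (hv0 t)
  · simp only [vecMulVec_apply, ← Finset.mul_sum, hvS.2, mul_one]
  · rw [Finset.sum_comm]
    refine le_trans (le_of_eq ?_) (hcorr f)
    exact Finset.sum_congr rfl fun t _ => Finset.sum_congr rfl fun s _ => by
      rw [hB, vecMulVec_apply, transpose_apply, transpose_apply, mul_comm (v s)]
  · exact subset_convexHull ℝ _ ⟨v, hvS, rfl⟩
  · exact ⟨w s * w t, by simp [vecMulVec_apply, hv]⟩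
  · simpa [BimatrixGame.expectedUtility_vecMulVec] using hpure s
  · rw [BimatrixGame.expectedUtility_vecMulVec, BimatrixGame.expectedUtility_vecMulVec, hB,
      mulVec_transpose, mulVec_transpose, dotProduct_comm v, dotProduct_comm v,
      ← dotProduct_mulVec, ← dotProduct_mulVec]
    simpa using hpure t
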